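/- Let $G$ be a nonempty groupoid, that is, a small category with at least one object in which every morphism is invertible, with set of objects $G_0$ and source and range maps $s,r$, and let $R$ be a nonzero unital commutative ring. The groupoid ring $R[G]$ consists of the finite formal sums $\sum_{g} a_g\delta_g$ with $g$ ranging over the morphisms of $G$ and $a_g\in R$, with multiplication determined by $a\delta_g\cdot b\delta_h=ab\,\delta_{gh}$ if $s(g)=r(h)$, and $0$ otherwise. For $e\in G_0$ let $G_e^e=\{g\in G: s(g)=r(g)=e\}$ be the isotropy group and $\mathcal O_e=\{f\in G_0:\exists g\in G,\ s(g)=e,\ r(g)=f\}$ the orbit of $e$. A subset $X\subseteq G_0$ is called $R$-dense if for every nonzero $a=\sum_g a_g\delta_g\in R[G]$ there is a $g$ with $a_g\neq 0$ and $s(g)\in X$. A (not necessarily unital) ring $S$ is called prime if there are no nonzero two-sided ideals $I,J$ of $S$ with $IJ=\{0\}$. Then the following statements are equivalent: (i) $R[G]$ is prime; (ii) there is some $e\in G_0$ such that $\mathcal O_e$ is $R$-dense and the group ring $R[G_e^e]$ is prime; (iii) there is some $e\in G_0$ such that $\mathcal O_e$ is $R$-dense, $R$ is an integral domain, and $G_e^e$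 has no nontrivial finite normal subgroup. -/

import Mathlib

open CategoryTheory

universe u v w

/-- A ring (not assumed unital) is prime if it has no nonzero two-sided ideals `I`, `J`
with `I J = {0}`. The product `I J` is zero iff `x * y = 0` for all `x ∈ I`, `y ∈ J`. -/
def IsPrimeRing (S : Type u) [NonUnitalRing S] : Prop :=
  ¬ ∃ I J : TwoSidedIdeal S, I ≠ ⊥ ∧ J ≠ ⊥ ∧ ∀ x ∈ I, ∀ y ∈ J, x * y = 0

/-- The morphisms of a groupoid, bundled with their source and range. -/
structure GroupoidMor (C : Type v) [Groupoid.{w} C] where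
  source : C
  range : C
  hom : source ⟶ range

namespace GroupoidMor

variable {C : Type v} [Groupoid.{w} C]

/-- The product `g h` (first `h`, then `g`) of a composable pair, `s(g) = r(h)`. -/
def comp (g h : GroupoidMor C) (hgh : g.source = h.range) : GroupoidMor C :=
  ⟨h.source, g.range, h.hom ≫ eqToHom hgh.symm ≫ g.hom⟩

theorem comp_assoc (g h k : GroupoidMor C) (h₁ : g.source = h.range) (h₂ : h.source = k.range) :
    comp (comp g h h₁) k h₂ = comp g (comp h k h₂) h₁ := by
  simp [comp]

end GroupoidMor

/-- The groupoid ring `R[G]`: finite formal sums `∑ a_g δ_g` over the morphisms `g` of `G`. -/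
def GroupoidRing (R : Type u) (C : Type v) [Ring R] [Groupoid.{w} C] : Type (max u v w) :=
  GroupoidMor C →₀ R

namespace GroupoidRing

variable {R : Type u} {C : Type v} [Ring R] [Groupoid.{w} C]

noncomputable instance : AddCommGroup (GroupoidRing R C) :=
  inferInstanceAs (AddCommGroup (GroupoidMor C →₀ R))

/-- The coefficient `a_g` of `a = ∑ a_g δ_g`. -/
def coeff (a : GroupoidRing R C) (g : GroupoidMor C) : R :=
  (show GroupoidMor C →₀ R from a) g

/-- The element `x δ_g`. -/
noncomputable def single (g : GroupoidMor C) (x : R) : GroupoidRing R C :=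
  (Finsupp.single g x : GroupoidMor C →₀ R)

open Classical in
/-- `(x δ_g) (y δ_h)`, which is `x y δ_{gh}` if `g`, `h` are composable, and `0` otherwise. -/
noncomputable def singleMul (g : GroupoidMor C) (x : R) (h : GroupoidMor C) (y : R) :
    GroupoidRing R C :=
  if hgh : g.source = h.range then single (g.comp h hgh) (x * y) else 0

theorem single_zero (g : GroupoidMor C) : single g (0 : R) = 0 :=
  Finsupp.single_zero g

theorem single_add (g : GroupoidMor C) (x y : R) :
    single g (x + y) = single g x + single g y :=
  Finsupp.single_add g x y

theorem singleMul_zero_left (g : GroupoidMor C) (h : GroupoidMor C) (y : R) :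
    singleMul g 0 h y = 0 := by
  simp [singleMul, single_zero]

theorem singleMul_zero_right (g : GroupoidMor C) (x : R) (h : GroupoidMor C) :
    singleMul g x h 0 = 0 := by
  simp [singleMul, single_zero]

theorem singleMul_add_left (g : GroupoidMor C) (x x' : R) (h : GroupoidMor C) (y : R) :
    singleMul g (x + x') h y = singleMul g x h y + singleMul g x' h y := by
  unfold singleMul
  split_ifs
  · rw [add_mul, single_add]
  · simp

theorem singleMul_add_right (g : GroupoidMor C) (x : R) (h : GroupoidMor C) (y y' : R) :
    singleMul g x h (y + y') = singleMul g x h y + singleMul g x h y' := by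
  unfold singleMul
  split_ifs
  · rw [mul_add, single_add]
  · simp

/-- The biadditive extension of `singleMul`. -/
noncomputable instance : Mul (GroupoidRing R C) where
  mul a b := Finsupp.sum (show GroupoidMor C →₀ R from a) fun g x =>
    Finsupp.sum (show GroupoidMor C →₀ R from b) fun h y => singleMul g x h y

theorem mul_def (a b : GroupoidRing R C) :
    a * b = Finsupp.sum (show GroupoidMor C →₀ R from a) fun g x =>
      Finsupp.sum (show GroupoidMor C →₀ R from b) fun h y => singleMul g x h y :=
  rfl

theorem single_mul_single (g : GroupoidMor C) (x : R) (h : GroupoidMor C) (y : R) :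
    single g x * single h y = singleMul g x h y := by
  rw [mul_def]
  refine (Finsupp.sum_single_index ?_).trans (Finsupp.sum_single_index ?_)
  · exact Finset.sum_eq_zero fun _ _ => singleMul_zero_left _ _ _
  · exact singleMul_zero_right g x h

protected theorem zero_mul (a : GroupoidRing R C) : 0 * a = 0 :=
  Finsupp.sum_zero_index

protected theorem mul_zero (a : GroupoidRing R C) : a * 0 = 0 := by
  rw [mul_def]
  exact Finset.sum_eq_zero fun _ _ => Finsupp.sum_zero_index

protected theorem add_mul (a b c : GroupoidRing R C) : (a + b) * c = a * c + b * c := by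
  classical
  refine Finsupp.sum_add_index' (fun g => ?_) (fun g x y => ?_)
  · exact Finset.sum_eq_zero fun _ _ => singleMul_zero_left _ _ _
  · simp only [singleMul_add_left]
    exact Finsupp.sum_add

protected theorem mul_add (a b c : GroupoidRing R C) : a * (b + c) = a * b + a * c := by
  classical
  refine Eq.trans (Finset.sum_congr rfl fun g _ => ?_) Finset.sum_add_distrib
  exact Finsupp.sum_add_index' (fun h => singleMul_zero_right _ _ h)
    (fun h x y => singleMul_add_right _ _ h x y)

theorem induction_linear {p : GroupoidRing R C → Prop} (a : GroupoidRing R C) (h0 : p 0)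
    (hadd : ∀ a b, p a → p b → p (a + b)) (hs : ∀ g x, p (single g x)) : p a :=
  Finsupp.induction_linear (motive := p) a h0 hadd hs

protected theorem mul_assoc (a b c : GroupoidRing R C) : a * b * c = a * (b * c) := by
  induction a using induction_linear with
  | h0 => simp only [GroupoidRing.zero_mul]
  | hadd a a' ha ha' => simp only [GroupoidRing.add_mul, ha, ha']
  | hs g x =>
    induction b using induction_linear with
    | h0 => simp only [GroupoidRing.zero_mul, GroupoidRing.mul_zero]
    | hadd b b' hb hb' => simp only [GroupoidRing.add_mul, GroupoidRing.mul_add, hb, hb']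
    | hs h y =>
      induction c using induction_linear with
      | h0 => simp only [GroupoidRing.mul_zero]
      | hadd c c' hc hc' => simp only [GroupoidRing.mul_add, hc, hc']
      | hs k z =>
        rw [single_mul_single, single_mul_single]
        unfold singleMul
        by_cases h₁ : g.source = h.range <;> by_cases h₂ : h.source = k.range
        · have h₃ : (g.comp h h₁).source = k.range := h₂
          have h₄ : g.source = (h.comp k h₂).range := h₁
          rw [dif_pos h₁, dif_pos h₂, single_mul_single, single_mul_single]
          unfold singleMul
          rw [dif_pos h₃, dif_pos h₄, mul_assoc]
          exact congrArg (fun m => single m (x * (y * z))) (GroupoidMor.comp_assoc g h k h₁ h₂)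
        · have h₃ : ¬ (g.comp h h₁).source = k.range := h₂
          rw [dif_pos h₁, dif_neg h₂, single_mul_single, GroupoidRing.mul_zero]
          unfold singleMul
          rw [dif_neg h₃]
        · have h₄ : ¬ g.source = (h.comp k h₂).range := h₁
          rw [dif_neg h₁, dif_pos h₂, single_mul_single, GroupoidRing.zero_mul]
          unfold singleMul
          rw [dif_neg h₄]
        · rw [dif_neg h₁, dif_neg h₂, GroupoidRing.zero_mul, GroupoidRing.mul_zero]

noncomputable instance : NonUnitalRing (GroupoidRing R C) where
  left_distrib := GroupoidRing.mul_add
  right_distrib := GroupoidRing.add_mul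
  zero_mul := GroupoidRing.zero_mul
  mul_zero := GroupoidRing.mul_zero
  mul_assoc := GroupoidRing.mul_assoc

end GroupoidRing

/-- A set `X` of objects is `R`-dense if every nonzero `a = ∑ a_g δ_g` in `R[G]` has some
`a_g ≠ 0` with `s(g) ∈ X`. -/
def IsRDense (R : Type u) {C : Type v} [Ring R] [Groupoid.{w} C] (X : Set C) : Prop :=
  ∀ a : GroupoidRing R C, a ≠ 0 → ∃ g : GroupoidMor C, a.coeff g ≠ 0 ∧ g.source ∈ X

/-- The orbit of an object `e`: all `f` for which there is a morphism from `e` to `f`. -/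
def groupoidOrbit {C : Type v} [Groupoid.{w} C] (e : C) : Set C :=
  {f | Nonempty (e ⟶ f)}

/-! ### Elementwise characterisation of prime rings -/

/-! With local units, primeness can be tested on elements: `a S b = 0` must force `a = 0` or `b =
0`. The equivalence of (i) and (ii) is then a corner argument. The group ring of the isotropy group
at `e` is the corner `δ_e R[G] δ_e`, and primeness passes to corners. Conversely, arrows to and from
`e` move a nonzero element into this corner without killing it (`single_mul_mul_single_ne_zero`). A
prime `R[G]` has one orbit, since `δ_f R[G] δ_e = 0` when no arrow goes from `e` to `f`.

The equivalence of (ii) and (iii) is Connell's theorem. The sum over a finite normal subgroup is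
central and kills `n - 1` for each `n` in it. For the converse, let `a R[Γ] b = 0` with `a`, `b`
nonzero, both translated to have `1` in their support. The part of `a` on finite conjugacy classes
still kills `b` (`finiteConjPart_mul_eq_zero`), and its support lies in a normal subgroup that is
finitely generated, abelian and torsion-free. Unique products there give a nonzero coefficient, a
contradiction. -/

theorem IsPrimeRing.of_forall_mul_mul {S : Type u} [NonUnitalRing S]
    (h : ∀ a b : S, (∀ s, a * s * b = 0) → a = 0 ∨ b = 0) : IsPrimeRing S := by
  rintro ⟨I, J, hI, hJ, hIJ⟩
  obtain ⟨a, haI, ha⟩ : ∃ a ∈ I, a ≠ 0 := by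
    by_contra! hc
    exact hI (eq_bot_iff.2 fun x hx => (TwoSidedIdeal.mem_bot _).2 (hc x hx))
  obtain ⟨b, hbJ, hb⟩ : ∃ b ∈ J, b ≠ 0 := by
    by_contra! hc
    exact hJ (eq_bot_iff.2 fun x hx => (TwoSidedIdeal.mem_bot _).2 (hc x hx))
  exact (h a b fun s => hIJ _ (I.mul_mem_right _ _ haI) _ hbJ).elim ha hb

/-- In a prime ring with right local units, `a S b = 0` forces `a = 0` or `b = 0`. -/
theorem IsPrimeRing.eq_zero_or_eq_zero {S : Type u} [NonUnitalRing S] (hS : IsPrimeRing S)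
    (hunit : ∀ x : S, ∃ s, x * s = x) {a b : S} (hab : ∀ s, a * s * b = 0) :
    a = 0 ∨ b = 0 := by
  by_contra! hne
  let I : TwoSidedIdeal S := TwoSidedIdeal.mk' {x | ∀ s, x * s * b = 0}
    (fun s => by simp) (fun hx hy s => by simp [add_mul, hx s, hy s])
    (fun hx s => by simp [hx s])
    (fun {x y} hy s => by rw [mul_assoc x y, mul_assoc x, hy s, mul_zero])
    (fun {x y} hx s => by rw [mul_assoc x y]; exact hx _)
  -- Annihilating `I S` instead of `I` puts `b` in `J` by definition; the local unit `x = x * s`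
  -- then upgrades `I S J = 0` to `I J = 0`.
  let J : TwoSidedIdeal S := TwoSidedIdeal.mk' {y | ∀ x ∈ I, ∀ s, x * s * y = 0}
    (fun x _ s => by simp) (fun hy hz x hx s => by simp [mul_add, hy x hx s, hz x hx s])
    (fun hy x hx s => by simp [hy x hx s])
    (fun {z y} hy x hx s => by rw [← mul_assoc, mul_assoc x]; exact hy x hx _)
    (fun {y z} hy x hx s => by rw [← mul_assoc, hy x hx s, zero_mul])
  have haI : a ∈ I := (TwoSidedIdeal.mem_mk' ..).2 hab
  have hbJ : b ∈ J := (TwoSidedIdeal.mem_mk' ..).2 fun x hx => (TwoSidedIdeal.mem_mk' ..).1 hx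
  refine hS ⟨I, J, ?_, ?_, fun x hx y hy => ?_⟩
  · intro h
    exact hne.1 ((TwoSidedIdeal.mem_bot _).1 (h ▸ haI))
  · intro h
    exact hne.2 ((TwoSidedIdeal.mem_bot _).1 (h ▸ hbJ))
  · obtain ⟨s, hs⟩ := hunit x
    have := (TwoSidedIdeal.mem_mk' ..).1 hy x hx s
    rwa [hs] at this

/-! ### Elements with finitely many conjugates -/

section FiniteConjugates

open scoped commutatorElement

variable {Γ : Type u} [Group Γ]

/-- Orbit-stabiliser for conjugation; `index` and `ncard` are both `0` in the infinite case, so one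
equality gives both directions. -/
theorem finiteIndex_centralizer_iff_finite_conjugatesOf (g : Γ) :
    (Subgroup.centralizer {g}).FiniteIndex ↔ (conjugatesOf g).Finite := by
  have h1 : (Subgroup.centralizer {g}).index = (conjugatesOf g).ncard := by
    have := MulAction.index_stabilizer (ConjAct Γ) g
    rw [ConjAct.stabilizer_eq_centralizer, ConjAct.orbit_eq_carrier_conjClasses] at this
    exact this
  rw [Subgroup.finiteIndex_iff, h1]
  exact ⟨Set.finite_of_ncard_ne_zero, fun h => Set.ncard_ne_zero_of_mem mem_conjugatesOf_self h⟩

theorem finiteIndex_centralizer_of_finite {S : Set Γ} (hS : S.Finite)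
    (h : ∀ s ∈ S, (Subgroup.centralizer {s}).FiniteIndex) :
    (Subgroup.centralizer S).FiniteIndex := by
  rw [Subgroup.centralizer_eq_iInf]
  have := Subgroup.finiteIndex_iInf' (s := hS.toFinset) (fun g : Γ => Subgroup.centralizer {g})
    (by simpa using h)
  simpa using this

/-- A group whose centre has finite index has finite commutator subgroup. -/
theorem finite_commutator_of_finiteIndex_center (H : Type u) [Group H]
    [(Subgroup.center H).FiniteIndex] : Finite (commutator H) := by
  have : Finite (H ⧸ Subgroup.center H) := Subgroup.finite_quotient_of_finiteIndex
  have : Finite (commutatorSet H) := by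
    refine Set.Finite.subset (Set.finite_range
      fun p : (H ⧸ Subgroup.center H) × (H ⧸ Subgroup.center H) => ⁅p.1.out, p.2.out⁆) ?_
    rintro _ ⟨x, y, rfl⟩
    obtain ⟨z, hz⟩ := QuotientGroup.mk_out_eq_mul (Subgroup.center H) x
    obtain ⟨t, ht⟩ := QuotientGroup.mk_out_eq_mul (Subgroup.center H) y
    refine ⟨((x : H ⧸ Subgroup.center H), (y : H ⧸ Subgroup.center H)), ?_⟩
    -- A commutator depends only on the classes of its entries modulo the centre, so there are
    -- finitely many commutators.
    have key : ∀ (a b : H) (c : Subgroup.center H), ⁅a * (c : H), b⁆ = ⁅a, b⁆ := fun a b c => by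
      have hc := Subgroup.mem_center_iff.1 c.2 b
      rw [commutatorElement_def, commutatorElement_def, mul_inv_rev, mul_assoc a, ← hc]
      group
    have hxt : ⁅x, y * (t : H)⁆ = ⁅x, y⁆ := by
      rw [← commutatorElement_inv, key, commutatorElement_inv]
    change ⁅(x : H ⧸ Subgroup.center H).out, (y : H ⧸ Subgroup.center H).out⁆ = _
    rw [hz, ht, key, hxt]
  -- Schur's theorem: finitely many commutators generate a finite subgroup.
  infer_instance

theorem Subgroup.fg_of_commGroup_fg {A : Type u} [CommGroup A] [Group.FG A] (H : Subgroup A) :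
    Group.FG H := by
  have : Module.Finite ℤ (Additive A) := Module.Finite.iff_addGroup_fg.2 inferInstance
  have h := IsNoetherian.noetherian (AddSubgroup.toIntSubmodule H.toAddSubgroup)
  rw [Group.fg_iff_subgroup_fg, Subgroup.fg_iff_add_fg]
  exact (Submodule.fg_iff_addSubgroup_fg _).1 h

/-- In a group without nontrivial finite normal subgroups, finitely many elements with finite
conjugacy classes lie in a normal subgroup with the unique products property. -/
theorem uniqueProds_normalClosure
    (hΓ : ∀ N : Subgroup Γ, N.Normal → Finite N → N = ⊥) {S : Set Γ} (hS : S.Finite)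
    (h : ∀ s ∈ S, (Subgroup.centralizer {s}).FiniteIndex) :
    UniqueProds (Subgroup.normalClosure S) := by
  have hfin : (Group.conjugatesOfSet S).Finite :=
    hS.biUnion fun s hs => (finiteIndex_centralizer_iff_finite_conjugatesOf s).1 (h s hs)
  have hC : (Subgroup.centralizer (Group.conjugatesOfSet S)).FiniteIndex := by
    refine finiteIndex_centralizer_of_finite hfin fun t ht => ?_
    obtain ⟨s, hs, hst⟩ := Group.mem_conjugatesOfSet_iff.1 ht
    rw [finiteIndex_centralizer_iff_finite_conjugatesOf, ← hst.conjugatesOf_eq,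
      ← finiteIndex_centralizer_iff_finite_conjugatesOf]
    exact h s hs
  have hHC : Subgroup.centralizer (Group.conjugatesOfSet S) =
      Subgroup.centralizer (Subgroup.normalClosure S : Set Γ) :=
    (Subgroup.centralizer_closure _).symm
  set H := Subgroup.normalClosure S with hH
  have hfg : Group.FG H := by
    have := hfin.to_subtype
    exact Group.closure_finite_fg _
  have hcen : (Subgroup.center H).FiniteIndex := by
    rw [hHC] at hC
    have : ((Subgroup.centralizer (H : Set Γ)).subgroupOf H).FiniteIndex := inferInstance
    refine Subgroup.finiteIndex_of_le
      (H := (Subgroup.centralizer (H : Set Γ)).subgroupOf H) fun x hx => ?_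
    rw [Subgroup.mem_center_iff]
    intro y
    exact Subtype.ext (Subgroup.mem_centralizer_iff.1 (Subgroup.mem_subgroupOf.1 hx) y y.2)
  -- The commutator subgroup is characteristic in the normal subgroup `H`, so its image is a finite
  -- normal subgroup of `Γ`.
  have hcomm : commutator H = ⊥ := by
    have := finite_commutator_of_finiteIndex_center H
    refine (Subgroup.map_eq_bot_iff_of_injective _ H.subtype_injective).1
      (hΓ _ ConjAct.normal_of_characteristic_of_normal ?_)
    exact ((Set.toFinite (commutator H : Set H)).image H.subtype).to_subtype
  have hmul : ∀ x y : H, x * y = y * x := fun x y => by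
    have hx : y ∈ Subgroup.center H := by
      rw [(commutator_eq_bot_iff_center_eq_top H).1 hcomm]; trivial
    exact Subgroup.mem_center_iff.1 hx x
  let _ : CommGroup H := { (inferInstance : Group H) with mul_comm := hmul }
  -- The torsion of a finitely generated abelian group is finite, and here it is normal in `Γ`.
  have htor : (CommGroup.torsion H).map H.subtype = ⊥ := by
    refine hΓ _ ⟨?_⟩ ?_
    · rintro _ ⟨x, hx, rfl⟩ g
      refine ⟨⟨g * x * g⁻¹, Subgroup.normalClosure_normal.conj_mem _ x.2 g⟩, ?_, rfl⟩
      obtain ⟨n, hn, hxn⟩ := isOfFinOrder_iff_pow_eq_one.1 hx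
      refine isOfFinOrder_iff_pow_eq_one.2 ⟨n, hn, Subtype.ext ?_⟩
      have : (x : Γ) ^ n = 1 := congrArg Subtype.val hxn
      simp [conj_pow, this]
    · have := Subgroup.fg_of_commGroup_fg (CommGroup.torsion H)
      have : Finite (CommGroup.torsion H) :=
        CommGroup.finite_of_fg_isMulTorsion _ CommMonoid.torsion.isMulTorsion
      exact ((Set.toFinite (CommGroup.torsion H : Set H)).image H.subtype).to_subtype
  have : IsMulTorsionFree H := by
    refine isMulTorsionFree_iff_not_isOfFinOrder.2 fun x hx hfin => hx ?_
    have : (x : Γ) ∈ (CommGroup.torsion H).map H.subtype := ⟨x, hfin, rfl⟩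
    rw [htor, Subgroup.mem_bot] at this
    exact Subtype.ext this
  infer_instance

end FiniteConjugates

/-! ### Prime group rings -/

section GroupRing

variable {R : Type u} {Γ : Type v} [Group Γ]

open MonoidAlgebra
open scoped Pointwise

open Classical in
/-- The part of an element of a group ring supported on the elements with finite conjugacy class. -/
noncomputable def MonoidAlgebra.finiteConjPart [Ring R] (a : MonoidAlgebra R Γ) :
    MonoidAlgebra R Γ :=
  ofCoeff (a.coeff.filter fun g => (Subgroup.centralizer {g}).FiniteIndex)

-- If `z` is in the support of `a₀ * b`, conjugating by `x` in the centralizer `W` of the support of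
-- `a₀` fixes `a₀`, so `z` must cancel against `(x * a₁ * x⁻¹) * b`. For each pair `(g, k)` of
-- support elements, the `x` with `x * g * x⁻¹ = z * k⁻¹` lie in one coset of the centralizer of
-- `g`, of infinite index. Finitely many such cosets cover `W`, against B. H. Neumann's lemma.
open Classical in
theorem MonoidAlgebra.finiteConjPart_mul_eq_zero [Ring R] {a b : MonoidAlgebra R Γ}
    (h : ∀ x : Γ, a * single x 1 * b = 0) : a.finiteConjPart * b = 0 := by
  set P : Γ → Prop := fun g => (Subgroup.centralizer {g}).FiniteIndex with hP
  set a₀ := a.finiteConjPart with ha₀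
  set a₁ : MonoidAlgebra R Γ := ofCoeff (a.coeff.filter fun g => ¬ P g) with ha₁
  have ha : a₀ + a₁ = a := coeff_injective (Finsupp.filter_add_filter_not a.coeff P)
  by_contra hne
  obtain ⟨z, hz⟩ : ∃ z, (a₀ * b).coeff z ≠ 0 := by
    by_contra! hc
    exact hne (coeff_injective (Finsupp.ext hc))
  set W := Subgroup.centralizer (a₀.coeff.support : Set Γ) with hWdef
  have hW : W.FiniteIndex := finiteIndex_centralizer_of_finite (Finset.finite_toSet _)
    fun s hs => (Finsupp.mem_support_iff.1 hs |> fun hs' => by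
      by_contra hc
      exact hs' (Finsupp.filter_apply_neg _ _ hc))
  have hfin : Finite (Γ ⧸ W) := Subgroup.finite_quotient_of_finiteIndex
  have := Fintype.ofFinite (Γ ⧸ W)
  -- every element of `W` conjugates some `g` in the support of `a₁` to `z h⁻¹`
  have hcov : ∀ x ∈ W, ∃ g ∈ a₁.coeff.support, ∃ k ∈ b.coeff.support, x * g * x⁻¹ = z * k⁻¹ := by
    intro x hx
    have hcomm : single x 1 * a₀ = a₀ * single x 1 := by
      ext y
      rw [coeff_single_mul_apply, coeff_mul_single_apply, one_mul, mul_one]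
      have hxm := Subgroup.mem_centralizer_iff.1 hx
      by_cases h1 : a₀.coeff (x⁻¹ * y) = 0
      · by_cases h2 : a₀.coeff (y * x⁻¹) = 0
        · rw [h1, h2]
        · have := hxm _ (Finsupp.mem_support_iff.2 h2)
          rw [inv_mul_cancel_right] at this
          conv_lhs => rw [this, inv_mul_cancel_left]
      · have := hxm _ (Finsupp.mem_support_iff.2 h1)
        rw [mul_inv_cancel_left] at this
        conv_rhs => rw [← this, mul_inv_cancel_right]
    have h0 : a₀ * b + single x 1 * a₁ * single x⁻¹ 1 * b = 0 := by
      have e1 : single x 1 * a₀ * single x⁻¹ 1 = a₀ := by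
        rw [hcomm, mul_assoc, single_mul_single, mul_inv_cancel, mul_one, ← one_def, mul_one]
      have := congrArg (single x 1 * ·) (h x⁻¹)
      simp only [mul_zero] at this
      rw [← ha, ← mul_assoc, ← mul_assoc, mul_add, add_mul, add_mul, e1] at this
      exact this
    have hz' : (single x 1 * a₁ * single x⁻¹ 1 * b).coeff z ≠ 0 := by
      intro hc
      have := congrArg (fun c => coeff c z) h0
      simp only [coeff_add, Finsupp.add_apply, hc, add_zero, coeff_zero, Finsupp.zero_apply] at this
      exact hz this
    obtain ⟨y, hy, k, hk, hyk⟩ := Finset.mem_mul.1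
      (support_coeff_mul_subset _ _ (Finsupp.mem_support_iff.2 hz'))
    rw [Finsupp.mem_support_iff, coeff_mul_single_apply, coeff_single_mul_apply, one_mul,
      mul_one] at hy
    refine ⟨_, Finsupp.mem_support_iff.2 hy, k, hk, ?_⟩
    rw [← hyk]
    group
  -- One conjugator per pair; the default `1` serves pairs without one, whose cosets are not needed
  -- for the cover.
  let C : Γ × Γ → Γ := fun p =>
    if hp : ∃ x, x * p.1 * x⁻¹ = z * p.2⁻¹ then hp.choose else 1
  let rep : (Γ × Γ) ⊕ (Γ ⧸ W) → Γ := Sum.elim C Quotient.out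
  let sub : (Γ × Γ) ⊕ (Γ ⧸ W) → Subgroup Γ :=
    Sum.elim (fun p => Subgroup.centralizer {p.1}) (fun _ => W)
  -- The nontrivial cosets of `W` complete the cover of `W` to one of `Γ`.
  let T : Finset ((Γ × Γ) ⊕ (Γ ⧸ W)) :=
    (a₁.coeff.support ×ˢ b.coeff.support).disjSum (Finset.univ.erase ((1 : Γ) : Γ ⧸ W))
  have hT : ⋃ i ∈ T, rep i • (sub i : Set Γ) = Set.univ := by
    refine Set.eq_univ_of_forall fun x => ?_
    simp only [Set.mem_iUnion]
    by_cases hx : x ∈ W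
    · obtain ⟨g, hg, k, hk, hgk⟩ := hcov x hx
      refine ⟨Sum.inl (g, k), ?_, ?_⟩
      · simp only [T, Finset.inl_mem_disjSum, Finset.mem_product]
        exact ⟨hg, hk⟩
      have hp : ∃ x, x * g * x⁻¹ = z * k⁻¹ := ⟨x, hgk⟩
      have hC : C (g, k) = hp.choose := dif_pos hp
      rw [mem_leftCoset_iff]
      change (C (g, k))⁻¹ * x ∈ Subgroup.centralizer {g}
      rw [Subgroup.mem_centralizer_singleton_iff, hC]
      have hy := hp.choose_spec
      set y := hp.choose
      have : y * g * y⁻¹ = x * g * x⁻¹ := hy.trans hgk.symm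
      calc y⁻¹ * x * g = y⁻¹ * (x * g * x⁻¹) * x := by group
        _ = g * (y⁻¹ * x) := by rw [← this]; group
    · refine ⟨Sum.inr (x : Γ ⧸ W), ?_, ?_⟩
      · simp only [T, Finset.inr_mem_disjSum, Finset.mem_erase, Finset.mem_univ, and_true]
        intro hc
        exact hx (by simpa using QuotientGroup.eq.1 hc.symm)
      · rw [mem_leftCoset_iff]
        exact QuotientGroup.eq.1 (QuotientGroup.out_eq' _)
  -- By Neumann's lemma the cosets of finite index subgroups already cover; these are the nontrivial
  -- cosets of `W`, which miss `1`.
  have h1 := Set.eq_univ_iff_forall.1 (Subgroup.leftCoset_cover_filter_FiniteIndex hT) 1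
  simp only [Set.mem_iUnion, Finset.mem_filter] at h1
  obtain ⟨i | q, ⟨hiT, hi⟩, hmem⟩ := h1
  · simp only [T, Finset.inl_mem_disjSum, Finset.mem_product] at hiT
    exact Finsupp.mem_support_iff.1 hiT.1 (Finsupp.filter_apply_neg _ _ (not_not.2 hi))
  · simp only [T, Finset.inr_mem_disjSum, Finset.mem_erase] at hiT
    rw [mem_leftCoset_iff] at hmem
    refine hiT.1 ?_
    rw [← QuotientGroup.out_eq' q]
    exact QuotientGroup.eq.2 hmem

/-- If `A` lies in a subgroup with unique products and `B` meets this subgroup, then some product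
in `A * B` is uniquely represented. -/
theorem exists_uniqueMul_of_subset_subgroup {H : Subgroup Γ} [UniqueProds H] {A B : Finset Γ}
    (hA : A.Nonempty) (hAH : ∀ g ∈ A, g ∈ H) (hB : ∃ g ∈ B, g ∈ H) :
    ∃ g ∈ A, ∃ h ∈ B, UniqueMul A B g h := by
  have hinj : Function.Injective (Subtype.val : H → Γ) := Subtype.val_injective
  obtain ⟨g₀, hg₀⟩ := hA
  obtain ⟨k₀, hk₀, hk₀H⟩ := hB
  obtain ⟨g, hg, h, hh, hu⟩ := UniqueProds.uniqueMul_of_nonempty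
    (A := A.preimage _ hinj.injOn) (B := B.preimage _ hinj.injOn)
    ⟨⟨g₀, hAH _ hg₀⟩, Finset.mem_preimage.2 hg₀⟩ ⟨⟨k₀, hk₀H⟩, Finset.mem_preimage.2 hk₀⟩
  refine ⟨g, Finset.mem_preimage.1 hg, h, Finset.mem_preimage.1 hh, fun x y hx hy hxy => ?_⟩
  -- Elements of `B` outside `H` cannot compete, since the product and the left factor lie in `H`.
  have hyH : y ∈ H := by
    have : x * y ∈ H := hxy ▸ H.mul_mem g.2 h.2
    exact (H.mul_mem_cancel_left (hAH x hx)).1 this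
  have := hu (a := ⟨x, hAH x hx⟩) (b := ⟨y, hyH⟩) (Finset.mem_preimage.2 hx)
    (Finset.mem_preimage.2 hy) (Subtype.ext hxy)
  exact ⟨congrArg Subtype.val this.1, congrArg Subtype.val this.2⟩

theorem isPrimeRing_monoidAlgebra [Ring R] [NoZeroDivisors R]
    (hΓ : ∀ N : Subgroup Γ, N.Normal → Finite N → N = ⊥) :
    IsPrimeRing (MonoidAlgebra R Γ) := by
  refine .of_forall_mul_mul fun a b hab => ?_
  by_contra! hne
  obtain ⟨g, hg⟩ : ∃ g, a.coeff g ≠ 0 := by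
    by_contra! hc
    exact hne.1 (coeff_injective (Finsupp.ext hc))
  obtain ⟨h, hh⟩ : ∃ h, b.coeff h ≠ 0 := by
    by_contra! hc
    exact hne.2 (coeff_injective (Finsupp.ext hc))
  -- The element `1` has a finite class and lies in every subgroup, so the translated `a` has
  -- nonzero `finiteConjPart` and the support of `b'` meets `H`.
  set a' := single g⁻¹ 1 * a
  set b' := b * single h⁻¹ 1
  have ha' : a'.coeff 1 ≠ 0 := by simpa [a', coeff_single_mul_apply] using hg
  have hb' : b'.coeff 1 ≠ 0 := by simpa [b', coeff_mul_single_apply] using hh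
  have hab' : a'.finiteConjPart * b' = 0 := finiteConjPart_mul_eq_zero fun x => by
    have := hab (single x 1)
    simp only [a', b', ← mul_assoc]
    rw [mul_assoc (single g⁻¹ 1), mul_assoc (single g⁻¹ 1), this, mul_zero, zero_mul]
  set a₀ := a'.finiteConjPart with ha₀
  have h1 : (1 : Γ) ∈ a₀.coeff.support := by
    classical
    rw [Finsupp.mem_support_iff]
    have : a₀.coeff 1 = a'.coeff 1 := Finsupp.filter_apply_pos _ _ (by
      have : Subgroup.centralizer {(1 : Γ)} = ⊤ := by
        ext; simp [Subgroup.mem_centralizer_singleton_iff]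
      rw [this]; infer_instance)
    rwa [this]
  have := uniqueProds_normalClosure hΓ (Finset.finite_toSet a₀.coeff.support) fun s hs => by
    by_contra hc
    classical
    exact Finsupp.mem_support_iff.1 hs (Finsupp.filter_apply_neg _ _ hc)
  obtain ⟨x, hx, y, hy, hu⟩ := exists_uniqueMul_of_subset_subgroup ⟨1, h1⟩
    (fun s hs => Subgroup.subset_normalClosure (Finset.mem_coe.2 hs))
    ⟨1, Finsupp.mem_support_iff.2 hb', Subgroup.one_mem _⟩
  have := coeff_mul_mul_of_uniqueMul hu
  rw [hab'] at this
  exact mul_ne_zero (Finsupp.mem_support_iff.1 hx) (Finsupp.mem_support_iff.1 hy) this.symm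

theorem noZeroDivisors_of_isPrimeRing_monoidAlgebra [CommRing R]
    (hp : IsPrimeRing (MonoidAlgebra R Γ)) : NoZeroDivisors R := by
  refine ⟨fun {x y} hxy => ?_⟩
  have := hp.eq_zero_or_eq_zero (fun x => ⟨1, mul_one x⟩) (a := single 1 x) (b := single 1 y)
    fun s => by
      rw [mul_assoc, ← single_one_comm, ← mul_assoc, single_mul_single, hxy]
      simp
  simpa using this

/-- The sum `a` over `N` is central by normality and absorbs `n`, so `a * s * (n - 1) = s * a * (n -
1) = 0`. -/
theorem eq_bot_of_isPrimeRing_monoidAlgebra [Ring R] [Nontrivial R]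
    (hp : IsPrimeRing (MonoidAlgebra R Γ)) (N : Subgroup Γ) (hN : N.Normal) (hfin : Finite N) :
    N = ⊥ := by
  rw [Subgroup.eq_bot_iff_forall]
  intro n hn
  have := Fintype.ofFinite N
  let a : MonoidAlgebra R Γ := ∑ m : N, single (m : Γ) 1
  have hmul : a * single n 1 = a := by
    simp only [a, Finset.sum_mul, single_mul_single, mul_one]
    exact Equiv.sum_comp (Equiv.mulRight (⟨n, hn⟩ : N)) fun m : N => single (m : Γ) (1 : R)
  have hconj : ∀ x : Γ, a * single x 1 = single x 1 * a := fun x => by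
    simp only [a, Finset.sum_mul, Finset.mul_sum, single_mul_single, mul_one]
    rw [← (MulAut.conjNormal x : MulAut N).toEquiv.sum_comp]
    refine Finset.sum_congr rfl fun m _ => ?_
    simp
  have hcomm : ∀ s, a * s = s * a := fun s => by
    induction s using MonoidAlgebra.induction_linear with
    | zero => simp
    | add s t hs ht => rw [mul_add, add_mul, hs, ht]
    | single x r =>
      have hx : single x r = single 1 r * single x (1 : R) := by simp [single_mul_single]
      have hr : a * single 1 r = single 1 r * a := by
        simp [a, Finset.sum_mul, Finset.mul_sum, single_mul_single]
      rw [hx, ← mul_assoc, hr, mul_assoc, hconj, mul_assoc]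
  have ha : a ≠ 0 := by
    intro h0
    have := congrArg (fun c => coeff c 1) h0
    classical
    simp [a, coeff_sum, Finsupp.finsetSum_apply, Finsupp.single_apply] at this
  have := (hp.eq_zero_or_eq_zero (fun x => ⟨1, mul_one x⟩) (a := a) (b := single n 1 - 1)
    fun s => by rw [hcomm, mul_assoc, mul_sub, hmul, mul_one, sub_self, mul_zero]).resolve_left ha
  rw [sub_eq_zero, one_def] at this
  exact (single_left_inj one_ne_zero).1 this

end GroupRing

/-! ### Groupoid rings and isotropy groups -/

namespace GroupoidRing

variable {R : Type u} {C : Type v} [Ring R] [Groupoid.{w} C]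

theorem single_mk_mul_single_mk {x y z : C} (f : x ⟶ y) (g : y ⟶ z) (r s : R) :
    (single ⟨y, z, g⟩ r * single ⟨x, y, f⟩ s : GroupoidRing R C) =
      single ⟨x, z, f ≫ g⟩ (r * s) := by
  rw [single_mul_single, singleMul, dif_pos rfl]
  simp [GroupoidMor.comp]

theorem single_mul_single_of_ne {g h : GroupoidMor C} (hgh : g.source ≠ h.range) (r s : R) :
    (single g r * single h s : GroupoidRing R C) = 0 := by
  rw [single_mul_single, singleMul, dif_neg hgh]

theorem single_ne_zero {g : GroupoidMor C} {r : R} (hr : r ≠ 0) : single g r ≠ 0 :=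
  Finsupp.single_ne_zero.2 hr

theorem coeff_single_of_ne {g h : GroupoidMor C} (hgh : g ≠ h) (r : R) :
    (single g r).coeff h = 0 :=
  Finsupp.single_eq_of_ne' hgh

theorem exists_coeff_ne_zero {a : GroupoidRing R C} (ha : a ≠ 0) : ∃ g, a.coeff g ≠ 0 :=
  Finsupp.ne_iff.1 ha

/-- Groupoid rings have right local units. -/
theorem exists_mul_eq_self (a : GroupoidRing R C) : ∃ s, a * s = a := by
  classical
  suffices h : ∃ F : Finset C, ∀ F', F ⊆ F' →
      a * ∑ f ∈ F', single ⟨f, f, 𝟙 f⟩ 1 = a by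
    obtain ⟨F, hF⟩ := h
    exact ⟨_, hF F subset_rfl⟩
  induction a using induction_linear with
  | h0 => exact ⟨∅, fun F' _ => zero_mul _⟩
  | hadd a b ha hb =>
    obtain ⟨F, hF⟩ := ha
    obtain ⟨F', hF'⟩ := hb
    refine ⟨F ∪ F', fun K hK => ?_⟩
    rw [add_mul, hF K (Finset.union_subset_left hK), hF' K (Finset.union_subset_right hK)]
  | hs g r =>
    obtain ⟨x, y, g⟩ := g
    refine ⟨{x}, fun F hF => ?_⟩
    rw [Finset.mul_sum, Finset.sum_eq_single x]
    · rw [single_mk_mul_single_mk, Category.id_comp, mul_one]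
    · exact fun f _ hf => single_mul_single_of_ne (Ne.symm hf) _ _
    · exact fun h => absurd (hF (Finset.mem_singleton_self x)) h

theorem coeff_single_id_mul_mul_single_id (t : GroupoidRing R C) {x y : C} (g : x ⟶ y) :
    (single ⟨y, y, 𝟙 y⟩ 1 * t * single ⟨x, x, 𝟙 x⟩ 1).coeff ⟨x, y, g⟩ = t.coeff ⟨x, y, g⟩ := by
  induction t using induction_linear with
  | h0 => rw [mul_zero, zero_mul]
  | hadd a b ha hb =>
    rw [mul_add, add_mul]
    exact congrArg₂ (· + ·) ha hb
  | hs h r =>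
    obtain ⟨x', y', h⟩ := h
    by_cases hy : y = y'
    · subst hy
      rw [single_mk_mul_single_mk, one_mul, Category.comp_id]
      by_cases hx : x' = x
      · subst hx
        rw [single_mk_mul_single_mk, mul_one, Category.id_comp]
      · rw [single_mul_single_of_ne hx, coeff_single_of_ne]
        · rfl
        · exact fun hc => hx (congrArg GroupoidMor.source hc)
    · rw [single_mul_single_of_ne hy, zero_mul, coeff_single_of_ne]
      · rfl
      · exact fun hc => hy (congrArg GroupoidMor.range hc).symm

/-- Multiplying back by the inverse arrows recovers `δ_y t δ_x`, which has the same coefficient at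
`g` as `t`. -/
theorem single_mul_mul_single_ne_zero {t : GroupoidRing R C} {x y z v : C} {g : x ⟶ y}
    (ht : t.coeff ⟨x, y, g⟩ ≠ 0) (p : y ⟶ z) (q : v ⟶ x) :
    single ⟨y, z, p⟩ 1 * t * single ⟨v, x, q⟩ 1 ≠ 0 := by
  intro h0
  apply ht
  have hp : (single ⟨y, y, 𝟙 y⟩ 1 : GroupoidRing R C) =
      single ⟨z, y, inv p⟩ 1 * single ⟨y, z, p⟩ 1 := by
    rw [single_mk_mul_single_mk, IsIso.hom_inv_id, mul_one]
  have hq : (single ⟨x, x, 𝟙 x⟩ 1 : GroupoidRing R C) =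
      single ⟨v, x, q⟩ 1 * single ⟨x, v, inv q⟩ 1 := by
    rw [single_mk_mul_single_mk, IsIso.inv_hom_id, mul_one]
  have h1 : single ⟨y, y, 𝟙 y⟩ 1 * t * single ⟨x, x, 𝟙 x⟩ 1 = 0 := by
    rw [hp, hq, mul_assoc (single ⟨z, y, inv p⟩ 1), mul_assoc (single ⟨z, y, inv p⟩ 1),
      ← mul_assoc _ (single ⟨v, x, q⟩ 1), h0, zero_mul, mul_zero]
  rw [← coeff_single_id_mul_mul_single_id t g, h1]
  rfl

variable (R) in
/-- The inclusion of the group ring of an isotropy group into the groupoid ring. -/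
noncomputable def ofIsotropy (e : C) : MonoidAlgebra R (End e) →ₙ+* GroupoidRing R C where
  toFun a := (Finsupp.mapDomain (fun x : End e => (⟨e, e, x⟩ : GroupoidMor C)) a.coeff :
    GroupoidMor C →₀ R)
  map_zero' := Finsupp.mapDomain_zero
  map_add' _ _ := Finsupp.mapDomain_add
  map_mul' a b := by
    let F : MonoidAlgebra R (End e) →+ GroupoidRing R C :=
      { toFun := fun a => (Finsupp.mapDomain (fun x : End e => (⟨e, e, x⟩ : GroupoidMor C)) a.coeff :
          GroupoidMor C →₀ R)
        map_zero' := Finsupp.mapDomain_zero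
        map_add' := fun _ _ => Finsupp.mapDomain_add }
    have hF : ∀ (x : End e) (r : R), F (.single x r) = single ⟨e, e, x⟩ r :=
      fun x r => Finsupp.mapDomain_single
    change F (a * b) = F a * F b
    induction a using MonoidAlgebra.induction_linear with
    | zero => rw [zero_mul, map_zero, zero_mul]
    | add a a' ha ha' => rw [add_mul, map_add, map_add, add_mul, ha, ha']
    | single x r =>
      induction b using MonoidAlgebra.induction_linear with
      | zero => rw [mul_zero, map_zero, mul_zero]
      | add b b' hb hb' => rw [mul_add, map_add, map_add, mul_add, hb, hb']
      | single y s =>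
        rw [MonoidAlgebra.single_mul_single, hF, hF, hF, single_mk_mul_single_mk]
        rfl

theorem ofIsotropy_single {e : C} (x : End e) (r : R) :
    ofIsotropy R e (.single x r) = single ⟨e, e, x⟩ r :=
  Finsupp.mapDomain_single

theorem ofIsotropy_injective (e : C) : Function.Injective (ofIsotropy R e) := by
  refine (Finsupp.mapDomain_injective fun x y hxy => ?_).comp MonoidAlgebra.coeff_injective
  cases hxy
  rfl

/-- Only the arrows `x ⟶ y` in `t` survive, and they become loops at `e`. -/
theorem exists_ofIsotropy_eq (t : GroupoidRing R C) {e x y : C} (p : y ⟶ e) (q : e ⟶ x) :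
    ∃ s, ofIsotropy R e s = single ⟨y, e, p⟩ 1 * t * single ⟨e, x, q⟩ 1 := by
  induction t using induction_linear with
  | h0 => exact ⟨0, by rw [map_zero, mul_zero, zero_mul]⟩
  | hadd a b ha hb =>
    obtain ⟨s, hs⟩ := ha
    obtain ⟨s', hs'⟩ := hb
    exact ⟨s + s', by rw [map_add, hs, hs', mul_add, add_mul]⟩
  | hs h r =>
    obtain ⟨x', y', h⟩ := h
    by_cases hy : y = y'
    · subst hy
      by_cases hx : x' = x
      · subst hx
        refine ⟨.single (q ≫ h ≫ p) r, ?_⟩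
        rw [ofIsotropy_single, single_mk_mul_single_mk, single_mk_mul_single_mk, one_mul, mul_one]
      · refine ⟨0, ?_⟩
        rw [map_zero, single_mk_mul_single_mk, single_mul_single_of_ne hx]
    · refine ⟨0, ?_⟩
      rw [map_zero, single_mul_single_of_ne hy, zero_mul]

theorem ofIsotropy_mul_single_id {e : C} (a : MonoidAlgebra R (End e)) :
    ofIsotropy R e a * single ⟨e, e, 𝟙 e⟩ 1 = ofIsotropy R e a := by
  conv_rhs => rw [← mul_one a, map_mul, MonoidAlgebra.one_def, ofIsotropy_single]
  rfl

theorem single_id_mul_ofIsotropy {e : C} (a : MonoidAlgebra R (End e)) :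
    single ⟨e, e, 𝟙 e⟩ 1 * ofIsotropy R e a = ofIsotropy R e a := by
  conv_rhs => rw [← one_mul a, map_mul, MonoidAlgebra.one_def, ofIsotropy_single]
  rfl

theorem isPrimeRing_isotropy (hp : IsPrimeRing (GroupoidRing R C)) (e : C) :
    IsPrimeRing (MonoidAlgebra R (End e)) := by
  refine .of_forall_mul_mul fun a b hab => ?_
  have := hp.eq_zero_or_eq_zero exists_mul_eq_self (a := ofIsotropy R e a)
    (b := ofIsotropy R e b) fun t => by
      obtain ⟨s, hs⟩ := exists_ofIsotropy_eq t (𝟙 e) (𝟙 e)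
      rw [← ofIsotropy_mul_single_id a, ← single_id_mul_ofIsotropy b, ← mul_assoc,
        mul_assoc (ofIsotropy R e a), mul_assoc (ofIsotropy R e a), ← hs, ← map_mul, ← map_mul,
        hab, map_zero]
  simpa only [map_eq_zero_iff _ (ofIsotropy_injective e)] using this

theorem nonempty_hom_of_isPrimeRing [Nontrivial R] (hp : IsPrimeRing (GroupoidRing R C))
    (e f : C) : Nonempty (e ⟶ f) := by
  by_contra hne
  have := hp.eq_zero_or_eq_zero exists_mul_eq_self (a := single ⟨f, f, 𝟙 f⟩ 1)
    (b := single ⟨e, e, 𝟙 e⟩ 1) fun t => by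
      induction t using induction_linear with
      | h0 => rw [mul_zero, zero_mul]
      | hadd a b ha hb => rw [mul_add, add_mul, ha, hb, add_zero]
      | hs h r =>
        obtain ⟨x, y, h⟩ := h
        by_cases hy : f = y
        · subst hy
          by_cases hx : x = e
          · subst hx
            exact absurd ⟨h⟩ hne
          · rw [single_mk_mul_single_mk, single_mul_single_of_ne hx]
        · rw [single_mul_single_of_ne hy, zero_mul]
  exact this.elim (single_ne_zero one_ne_zero) (single_ne_zero one_ne_zero)

theorem isRDense_of_isPrimeRing [Nontrivial R] (hp : IsPrimeRing (GroupoidRing R C)) (e : C) :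
    IsRDense R (groupoidOrbit e) := fun a ha => by
  obtain ⟨g, hg⟩ := exists_coeff_ne_zero ha
  exact ⟨g, hg, nonempty_hom_of_isPrimeRing hp e g.source⟩

theorem isPrimeRing_of_isotropy {e : C} (hd : IsRDense R (groupoidOrbit e))
    (hp : IsPrimeRing (MonoidAlgebra R (End e))) : IsPrimeRing (GroupoidRing R C) := by
  refine .of_forall_mul_mul fun a b hab => ?_
  by_contra! hne
  obtain ⟨⟨x, y, g⟩, hg, ⟨q⟩⟩ := hd a hne.1
  obtain ⟨⟨x', y', g'⟩, hg', ⟨q'⟩⟩ := hd b hne.2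
  change e ⟶ x at q
  change e ⟶ x' at q'
  let p : y ⟶ e := inv (q ≫ g)
  let p' : y' ⟶ e := inv (q' ≫ g')
  obtain ⟨s, hs⟩ := exists_ofIsotropy_eq a p q
  obtain ⟨s', hs'⟩ := exists_ofIsotropy_eq b p' q'
  have h0 := hp.eq_zero_or_eq_zero (fun x => ⟨1, mul_one x⟩) (a := s) (b := s') fun t => by
    apply ofIsotropy_injective e
    rw [map_mul, map_mul, hs, hs', map_zero]
    -- This test element is what stands between `a` and `b` once `s * t * s'` is expanded.
    have := hab (single ⟨e, x, q⟩ 1 * ofIsotropy R e t * single ⟨y', e, p'⟩ 1)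
    calc _ = single ⟨y, e, p⟩ 1 *
          (a * (single ⟨e, x, q⟩ 1 * ofIsotropy R e t * single ⟨y', e, p'⟩ 1) * b) *
          single ⟨e, x', q'⟩ 1 := by simp only [mul_assoc]
      _ = 0 := by rw [this, mul_zero, zero_mul]
  rcases h0 with rfl | rfl
  · exact single_mul_mul_single_ne_zero hg p q (by rw [← hs, map_zero])
  · exact single_mul_mul_single_ne_zero hg' p' q' (by rw [← hs', map_zero])

end GroupoidRing

/-- The isotropy group of `e` is `End e`, whose product `g * h` is `g` after `h`. -/
theorem mainTheorem9 {R : Type u} {C : Type v} [CommRing R] [Nontrivial R] [Groupoid.{w} C]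
    [Nonempty C] :
    List.TFAE [
      IsPrimeRing (GroupoidRing R C),
      ∃ e : C, IsRDense R (groupoidOrbit e) ∧ IsPrimeRing (MonoidAlgebra R (End e)),
      ∃ e : C, IsRDense R (groupoidOrbit e) ∧ IsDomain R ∧
        ∀ N : Subgroup (End e), N.Normal → Finite N → N = ⊥] := by
  tfae_have 1 → 2 := fun hp =>
    -- Any object serves as `e`.
    let ⟨e⟩ := ‹Nonempty C›
    ⟨e, GroupoidRing.isRDense_of_isPrimeRing hp e, GroupoidRing.isPrimeRing_isotropy hp e⟩
  tfae_have 2 → 1 := fun ⟨_, hd, hp⟩ => GroupoidRing.isPrimeRing_of_isotropy hd hp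
  tfae_have 2 → 3 := fun ⟨e, hd, hp⟩ =>
    have := noZeroDivisors_of_isPrimeRing_monoidAlgebra hp
    ⟨e, hd, NoZeroDivisors.to_isDomain R, eq_bot_of_isPrimeRing_monoidAlgebra hp⟩
  tfae_have 3 → 2 := fun ⟨e, hd, _, hN⟩ => ⟨e, hd, isPrimeRing_monoidAlgebra hN⟩
  tfae_finish
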